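/- Let $(J,\mathcal B,\lambda)$ be a probability space and let $E\subseteq J\times J$ belong to the product sigma-algebra $\mathcal B\otimes\mathcal B$. For $X\subseteq J$ let $E(X)=\{y\in J:\ (x,y)\in E \text{ for some } x\in X\}$. For a set $Y\subseteq J$ not in $\mathcal B$, $\lambda(Y)$ denotes the outer measure $\inf\{\lambda(B): Y\subseteq B\in\mathcal B\}$; this is the value of the completion of $\lambda$ at $Y$ whenever $Y$ is measurable for the completion (as $E(X)$ always is, for $X\in\mathcal B$, if $(J,\mathcal B)$ is standard Borel). A finitely (respectively countably) additive coupling measure is a nonnegative finitely (respectively countably) additive measure $\alpha$ on $\mathcal B\otimes\mathcal B$ both of whose marginals are $\lambda$, that is, $\alpha(X\times J)=\alpha(J\times X)=\lambda(X)$ for all $X\in\mathcal B$. It is supported on $E$ if $\alpha((J\times J)\setminus E)=0$. (a) A finitely additive coupling measure supported on $E$ exists if and only if $$\lambda(X)\le\lambda(E(X))\qquad\text{for every } X\in\mathcal B. \tag{$*$}$$ (b) Suppose, in addition, that $\mathcal B$ is the sigma-algebra of Borel sets of a compact Hausdorff topology on $J$, that $\lambda$ is a regular Borel measure (which is automatic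 if the topology is metrizable), and that $E$ is closed in $J\times J$. If $(*)$ holds, then a countably additive coupling measure supported on $E$ exists. -/

import Mathlib

open MeasureTheory
open scoped ENNReal

/-- A finitely additive nonnegative measure on the measurable sets of `J`
(additivity over finite disjoint families of measurable sets, value `0` at `∅`). -/
abbrev FinAddMeasure (J : Type*) [MeasurableSpace J] : Type _ :=
  AddContent ℝ≥0∞ {U : Set J | MeasurableSet U}

/-- `α`, a finitely additive measure on the product sigma-algebra of `J × J`,
has both marginals equal to `l`. -/
def IsFinAddCoupling {J : Type*} [MeasurableSpace J] (l : Measure J)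
    (α : FinAddMeasure (J × J)) : Prop :=
  ∀ X : Set J, MeasurableSet X →
    α (X ×ˢ Set.univ) = l X ∧ α (Set.univ ×ˢ X) = l X

/-- `μ`, a countably additive measure on the product sigma-algebra of `J × J`,
has both marginals equal to `l`. -/
def IsCoupling {J : Type*} [MeasurableSpace J] (l : Measure J)
    (μ : Measure (J × J)) : Prop :=
  μ.fst = l ∧ μ.snd = l

/-- `l(X) ≤ l(E(X))` for all measurable `X`, where `E(X)` is the set of all `y` with
`(x, y) ∈ E` for some `x ∈ X`. On sets that are not measurable, `l` is the outer measure, which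
is the completion of `l` on the sets measurable for the completion. -/
def ExpansionCondition {J : Type*} [MeasurableSpace J] (l : Measure J)
    (E : Set (J × J)) : Prop :=
  ∀ X : Set J, MeasurableSet X → l X ≤ l (SetRel.image E X)

open Set

/-! Necessity holds because `X ×ˢ univ` lies in `(univ ×ˢ B) ∪ Eᶜ` for a measurable hull `B` of
`E(X)`. Sufficiency is linear duality. By the layer-cake formula, `(*)` says that `f(x) + g(y) ≥ 0`
on `E` forces `∫ f + ∫ g ≥ 0`. The M. Riesz extension theorem then yields a positive functional on
all bounded functions on `J × J`, blind to values off `E` and with the right marginals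
(`exists_functional`). Its values on indicators give (a). For (b), Riesz–Markov represents it on
continuous functions; it kills those vanishing on `E`, so the open set `Eᶜ` is null. -/

/-- The real vector space of bounded real functions on `α`. -/
def boundedFunctions (α : Type*) : Submodule ℝ (α → ℝ) where
  carrier := {f | ∃ C : ℝ, ∀ x, |f x| ≤ C}
  add_mem' := by
    rintro f g ⟨C, hC⟩ ⟨D, hD⟩
    exact ⟨C + D, fun x => (abs_add_le _ _).trans (add_le_add (hC x) (hD x))⟩
  zero_mem' := ⟨0, fun x => by simp⟩
  smul_mem' := by
    rintro c f ⟨C, hC⟩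
    refine ⟨|c| * C, fun x => ?_⟩
    simpa [abs_mul] using mul_le_mul_of_nonneg_left (hC x) (abs_nonneg c)

/-- The real vector space of bounded measurable real functions on `α`. -/
def boundedMeasurableFunctions (α : Type*) [MeasurableSpace α] : Submodule ℝ (α → ℝ) where
  carrier := {f | Measurable f ∧ ∃ C : ℝ, ∀ x, |f x| ≤ C}
  add_mem' := fun hf hg => ⟨hf.1.add hg.1, (boundedFunctions α).add_mem hf.2 hg.2⟩
  zero_mem' := ⟨measurable_zero, (boundedFunctions α).zero_mem⟩
  smul_mem' := fun c _ hf => ⟨hf.1.const_smul c, (boundedFunctions α).smul_mem c hf.2⟩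

theorem integrable_of_mem_boundedMeasurableFunctions {α : Type*} [MeasurableSpace α]
    (l : Measure α) [IsFiniteMeasure l] {f : α → ℝ} (hf : f ∈ boundedMeasurableFunctions α) :
    Integrable f l := by
  obtain ⟨hm, C, hC⟩ := hf
  exact Integrable.of_bound hm.aestronglyMeasurable C (ae_of_all _ hC)

/-- Integration as a linear functional on the bounded measurable functions. -/
noncomputable def boundedIntegral {α : Type*} [MeasurableSpace α] (l : Measure α)
    [IsFiniteMeasure l] : boundedMeasurableFunctions α →ₗ[ℝ] ℝ where
  toFun f := ∫ x, f.1 x ∂l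
  map_add' f g := integral_add (integrable_of_mem_boundedMeasurableFunctions l f.2)
    (integrable_of_mem_boundedMeasurableFunctions l g.2)
  map_smul' c f := integral_const_mul c f.1

theorem indicator_mem_boundedFunctions {α : Type*} (s : Set α) :
    s.indicator (fun _ => (1 : ℝ)) ∈ boundedFunctions α :=
  ⟨1, fun x => by by_cases h : x ∈ s <;> simp [h]⟩

theorem indicator_mem_boundedMeasurableFunctions {α : Type*} [MeasurableSpace α] {s : Set α}
    (hs : MeasurableSet s) :
    s.indicator (fun _ => (1 : ℝ)) ∈ boundedMeasurableFunctions α :=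
  ⟨measurable_const.indicator hs, indicator_mem_boundedFunctions s⟩

theorem ContinuousMap.mem_boundedFunctions {α : Type*} [TopologicalSpace α] [CompactSpace α]
    (f : C(α, ℝ)) : ⇑f ∈ boundedFunctions α :=
  ⟨‖f‖, fun x => f.norm_coe_le_norm x⟩

/-! ### Duality: a positive functional from the expansion condition -/

section Functional

variable {J : Type*} [MeasurableSpace J] {l : Measure J} {E : Set (J × J)}

/-- `E` carries `{u > t}` into `{v > t}`, so the expansion condition compares the superlevel sets
for each `t`. -/
theorem ExpansionCondition.lintegral_le (h : ExpansionCondition l E) {u v : J → ℝ}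
    (hu : Measurable u) (hv : Measurable v) (hu0 : ∀ x, 0 ≤ u x) (hv0 : ∀ x, 0 ≤ v x)
    (huv : ∀ p ∈ E, u p.1 ≤ v p.2) :
    ∫⁻ x, ENNReal.ofReal (u x) ∂l ≤ ∫⁻ x, ENNReal.ofReal (v x) ∂l := by
  rw [lintegral_eq_lintegral_meas_lt l (ae_of_all _ hu0) hu.aemeasurable,
    lintegral_eq_lintegral_meas_lt l (ae_of_all _ hv0) hv.aemeasurable]
  refine lintegral_mono fun t => (h _ (measurableSet_lt measurable_const hu)).trans
    (measure_mono ?_)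
  rintro y ⟨x, hx, hxy⟩
  exact lt_of_lt_of_le hx (huv (x, y) hxy)

theorem ExpansionCondition.integral_add_nonneg [IsProbabilityMeasure l]
    (h : ExpansionCondition l E) {f g : J → ℝ} (hf : f ∈ boundedMeasurableFunctions J)
    (hg : g ∈ boundedMeasurableFunctions J) (hfg : ∀ p ∈ E, 0 ≤ f p.1 + g p.2) :
    0 ≤ ∫ x, f x ∂l + ∫ x, g x ∂l := by
  have hfi := integrable_of_mem_boundedMeasurableFunctions l hf
  have hgi := integrable_of_mem_boundedMeasurableFunctions l hg
  obtain ⟨hfm, C, hC⟩ := hf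
  obtain ⟨hgm, D, hD⟩ := hg
  -- The shift by `C + D` makes both `-f` and `g` nonnegative; it cancels at the end.
  have hu0 : ∀ x, 0 ≤ C + D - f x := fun x => by
    have := (abs_le.1 (hC x)).2
    have := (abs_nonneg _).trans (hD x)
    linarith
  have hv0 : ∀ x, 0 ≤ C + D + g x := fun x => by
    have := (abs_le.1 (hD x)).1
    have := (abs_nonneg _).trans (hC x)
    linarith
  have key := h.lintegral_le (u := fun x => C + D - f x) (v := fun x => C + D + g x)
    (measurable_const.sub hfm) (measurable_const.add hgm) hu0 hv0
    (fun p hp => by linarith [hfg p hp])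
  have hui : Integrable (fun x => C + D - f x) l := (integrable_const _).sub hfi
  have hvi : Integrable (fun x => C + D + g x) l := (integrable_const _).add hgi
  rw [← ofReal_integral_eq_lintegral_ofReal hui (ae_of_all _ hu0),
    ← ofReal_integral_eq_lintegral_ofReal hvi (ae_of_all _ hv0),
    ENNReal.ofReal_le_ofReal_iff (integral_nonneg hv0),
    integral_sub (integrable_const _) hfi, integral_add (integrable_const _) hgi] at key
  linarith

/-- A positive functional on the bounded functions on `J × J` that is concentrated on `E` and
restricts to integration on functions of a single coordinate. -/
theorem ExpansionCondition.exists_functional [IsProbabilityMeasure l]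
    (h : ExpansionCondition l E) :
    ∃ Φ : boundedFunctions (J × J) →ₗ[ℝ] ℝ,
      (∀ k : boundedFunctions (J × J), (∀ p ∈ E, 0 ≤ k.1 p) → 0 ≤ Φ k) ∧
      ∀ (k : boundedFunctions (J × J)) (f g : boundedMeasurableFunctions J),
        (∀ p ∈ E, k.1 p = f.1 p.1 + g.1 p.2) → Φ k = ∫ x, f.1 x ∂l + ∫ x, g.1 x ∂l := by
  let V := boundedFunctions (J × J)
  let M := boundedMeasurableFunctions J
  -- Keeping `f` and `g` as separate coordinates makes `∫ f + ∫ g` well defined without uniqueness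
  -- of the decomposition `f(x) + g(y)`.
  let s : PointedCone ℝ (V × M × M) :=
    { carrier := {w | ∀ p ∈ E, 0 ≤ w.1.1 p + w.2.1.1 p.1 + w.2.2.1 p.2}
      add_mem' := fun {a b} ha hb p hp => by
        have h1 := ha p hp
        have h2 := hb p hp
        have h3 : (a + b).1.1 p + (a + b).2.1.1 p.1 + (a + b).2.2.1 p.2
          = (a.1.1 p + a.2.1.1 p.1 + a.2.2.1 p.2) + (b.1.1 p + b.2.1.1 p.1 + b.2.2.1 p.2) := by
          change (a.1.1 p + b.1.1 p) + (a.2.1.1 p.1 + b.2.1.1 p.1)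
            + (a.2.2.1 p.2 + b.2.2.1 p.2) = _
          ring
        rw [h3]
        exact add_nonneg h1 h2
      zero_mem' := fun p _ => by simp
      smul_mem' := fun c a ha p hp => by
        have h1 := ha p hp
        change 0 ≤ c.1 * a.1.1 p + c.1 * a.2.1.1 p.1 + c.1 * a.2.2.1 p.2
        rw [← mul_add, ← mul_add]
        exact mul_nonneg c.2 h1 }
  let I : V × M × M →ₗ[ℝ] ℝ :=
    ((boundedIntegral l).coprod (boundedIntegral l)).comp (LinearMap.snd ℝ V (M × M))
  let d : Submodule ℝ (V × M × M) := LinearMap.ker (LinearMap.fst ℝ V (M × M))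
  let F : (V × M × M) →ₗ.[ℝ] ℝ := ⟨d, I.comp d.subtype⟩
  have hnonneg : ∀ w : F.domain, (w : V × M × M) ∈ s → 0 ≤ F w := by
    rintro ⟨⟨k, f, g⟩, hk⟩ hs
    have hk0 : k = 0 := by simpa [F, d] using hk
    subst hk0
    refine h.integral_add_nonneg f.2 g.2 fun p hp => ?_
    have := hs p hp
    simpa using this
  -- Cancel `f` and `g`, then add the bound `C` of `k` through the first marginal.
  have hdense : ∀ w, ∃ v : F.domain, (v : V × M × M) + w ∈ s := by
    rintro ⟨⟨k, C, hC⟩, f, g⟩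
    let c : M := ⟨fun _ => C, measurable_const, |C|, fun _ => le_rfl⟩
    refine ⟨⟨(0, c - f, -g), by simp [F, d]⟩, fun p _ => ?_⟩
    change 0 ≤ (0 + k p) + ((C - f.1 p.1) + f.1 p.1) + (-(g.1 p.2) + g.1 p.2)
    linarith [(abs_le.1 (hC p)).1]
  obtain ⟨G, hG, hGs⟩ := riesz_extension s F hnonneg hdense
  have hI : ∀ f g : M, G (0, f, g) = ∫ x, f.1 x ∂l + ∫ x, g.1 x ∂l := fun f g =>
    hG ⟨(0, f, g), by simp [F, d]⟩
  refine ⟨G.comp (LinearMap.inl ℝ V (M × M)), fun k hk => hGs _ fun p hp => ?_, ?_⟩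
  · change 0 ≤ k.1 p + 0 + 0
    simpa using hk p hp
  · intro k f g hk
    -- On `E` the sum is zero, so this triple and its negative both lie in the cone.
    have h1 : 0 ≤ G (k, -f, -g) := hGs _ fun p hp => by
      change 0 ≤ k.1 p + -(f.1 p.1) + -(g.1 p.2)
      linarith [hk p hp]
    have h2 : 0 ≤ G (-k, f, g) := hGs _ fun p hp => by
      change 0 ≤ -(k.1 p) + f.1 p.1 + g.1 p.2
      linarith [hk p hp]
    have h3 : (k, -f, -g) = ((k, 0) : V × M × M) - (0, f, g) := by simp
    have h4 : (-k, f, g) = ((0, f, g) : V × M × M) - (k, 0) := by simp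
    rw [h3, map_sub, hI] at h1
    rw [h4, map_sub, hI] at h2
    change G (k, 0) = _
    linarith

end Functional

/-! ### Finitely additive couplings -/

/-- The finitely additive measure that a positive functional on bounded functions induces. -/
noncomputable def functionalContent {α : Type*} (C : Set (Set α))
    (Φ : boundedFunctions α →ₗ[ℝ] ℝ)
    (hΦ : ∀ k : boundedFunctions α, (∀ x, 0 ≤ k.1 x) → 0 ≤ Φ k) : AddContent ℝ≥0∞ C where
  toFun U := ENNReal.ofReal (Φ ⟨_, indicator_mem_boundedFunctions U⟩)
  empty' := by
    have : (⟨_, indicator_mem_boundedFunctions (∅ : Set α)⟩ : boundedFunctions α) = 0 :=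
      Subtype.ext (indicator_empty _)
    rw [this, map_zero, ENNReal.ofReal_zero]
  sUnion' I _ hd _ := by
    rw [← ENNReal.ofReal_sum_of_nonneg fun U _ =>
      hΦ _ fun x => indicator_nonneg (fun _ _ => zero_le_one) x, ← map_sum]
    congr 2
    refine Subtype.ext ?_
    rw [sUnion_eq_biUnion, Submodule.coe_sum (boundedFunctions α)]
    ext x
    rw [Finset.sum_apply]
    exact Finset.indicator_biUnion_apply I (f := fun _ => (1 : ℝ)) id hd x

theorem IsFinAddCoupling.expansionCondition {J : Type*} [MeasurableSpace J] {l : Measure J}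
    {E : Set (J × J)} (hE : MeasurableSet E) {α : FinAddMeasure (J × J)}
    (hα : IsFinAddCoupling l α) (h0 : α Eᶜ = 0) : ExpansionCondition l E := by
  intro X hX
  -- `E(X)` may fail to be measurable; its hull has the same outer measure.
  set B := toMeasurable l (SetRel.image E X)
  have hB : MeasurableSet B := measurableSet_toMeasurable _ _
  have hsub : X ×ˢ univ ⊆ (univ ×ˢ B) ∪ Eᶜ := by
    rintro ⟨x, y⟩ ⟨hx, -⟩
    by_cases hxy : (x, y) ∈ E
    · exact Or.inl ⟨mem_univ _, subset_toMeasurable _ _ ⟨x, hx, hxy⟩⟩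
    · exact Or.inr hxy
  have hring : IsSetRing {U : Set (J × J) | MeasurableSet U} :=
    { empty_mem := by simp
      union_mem := by simp +contextual [MeasurableSet.union]
      sdiff_mem := by simp +contextual [MeasurableSet.diff] }
  calc l X = α (X ×ˢ univ) := (hα X hX).1.symm
    _ ≤ α ((univ ×ˢ B) ∪ Eᶜ) := addContent_mono hring.isSetSemiring
        (hX.prod MeasurableSet.univ) ((MeasurableSet.univ.prod hB).union hE.compl) hsub
    _ ≤ α (univ ×ˢ B) + α Eᶜ := addContent_union_le hring
        (MeasurableSet.univ.prod hB) hE.compl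
    _ = l (SetRel.image E X) := by rw [h0, add_zero, (hα B hB).2, measure_toMeasurable]

theorem ExpansionCondition.exists_isFinAddCoupling {J : Type*} [MeasurableSpace J]
    {l : Measure J} [IsProbabilityMeasure l] {E : Set (J × J)} (h : ExpansionCondition l E) :
    ∃ α : FinAddMeasure (J × J), IsFinAddCoupling l α ∧ α Eᶜ = 0 := by
  obtain ⟨Φ, hpos, hmarg⟩ := h.exists_functional
  refine ⟨functionalContent _ Φ fun k hk => hpos k fun p _ => hk p, fun X hX => ?_, ?_⟩
  · have hint : ∫ x, X.indicator (fun _ => (1 : ℝ)) x ∂l = l.real X := by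
      simp [integral_indicator_const, hX]
    constructor
    · change ENNReal.ofReal (Φ _) = _
      rw [hmarg _ ⟨_, indicator_mem_boundedMeasurableFunctions hX⟩ 0
        fun p _ => by by_cases hp : p.1 ∈ X <;> simp [hp]]
      simp [hint]
    · change ENNReal.ofReal (Φ _) = _
      rw [hmarg _ 0 ⟨_, indicator_mem_boundedMeasurableFunctions hX⟩
        fun p _ => by by_cases hp : p.2 ∈ X <;> simp [hp]]
      simp [hint]
  · change ENNReal.ofReal (Φ _) = _
    rw [hmarg _ 0 0 fun p hp => by simp [hp]]
    simp

/-! ### Countably additive couplings on compact spaces -/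

/-- A positive functional on bounded functions is integration against a regular Borel measure
on the continuous functions on a compact Hausdorff space. -/
theorem exists_regular_measure_of_positive {X : Type*} [TopologicalSpace X] [CompactSpace X]
    [T2Space X] [MeasurableSpace X] [BorelSpace X] (Φ : boundedFunctions X →ₗ[ℝ] ℝ)
    (hΦ : ∀ k : boundedFunctions X, (∀ x, 0 ≤ k.1 x) → 0 ≤ Φ k) :
    ∃ μ : Measure X, μ.Regular ∧ IsFiniteMeasure μ ∧
      ∀ f : C(X, ℝ), ∫ x, f x ∂μ = Φ ⟨f, f.mem_boundedFunctions⟩ := by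
  let L : CompactlySupportedContinuousMap X ℝ →ₗ[ℝ] ℝ :=
    { toFun := fun f => Φ ⟨f.toContinuousMap, f.toContinuousMap.mem_boundedFunctions⟩
      map_add' := fun f g => by rw [← map_add]; rfl
      map_smul' := fun c f => by rw [RingHom.id_apply, ← map_smul]; rfl }
  let Λ := PositiveLinearMap.mk₀ L fun f hf => hΦ _ (CompactlySupportedContinuousMap.le_def.1 hf)
  exact ⟨RealRMK.rieszMeasure Λ, inferInstance, inferInstance, fun f =>
    RealRMK.integral_rieszMeasure Λ ⟨f, HasCompactSupport.of_compactSpace f⟩⟩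

/-- By inner regularity it suffices to treat compact `K ⊆ U`; a Urysohn function equal to `1` on `K`
and `0` off `U` has integral zero, so `K` is null. -/
theorem measure_eq_zero_of_integral_eq_zero {X : Type*} [TopologicalSpace X] [CompactSpace X]
    [T2Space X] [MeasurableSpace X] [BorelSpace X] {μ : Measure X} [μ.Regular] {U : Set X}
    (hU : IsOpen U) (h : ∀ f : C(X, ℝ), EqOn f 0 Uᶜ → ∫ x, f x ∂μ = 0) : μ U = 0 := by
  rw [hU.measure_eq_iSup_isCompact]
  simp only [ENNReal.iSup_eq_zero]
  intro K hKU hK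
  obtain ⟨f, hf0, hf1, hf⟩ := exists_continuous_zero_one_of_isClosed hU.isClosed_compl
    hK.isClosed (disjoint_compl_left_iff_subset.2 hKU)
  have hfi : Integrable f μ := f.continuous.integrable_of_hasCompactSupport
    (HasCompactSupport.of_compactSpace f)
  have hae := (integral_eq_zero_iff_of_nonneg (fun x => (hf x).1) hfi).1 (h f hf0)
  refine measure_mono_null (fun x hx => ?_) (ae_iff.1 hae)
  simp [hf1 hx]

theorem map_eq_of_integral_comp_eq {X Y : Type*} [TopologicalSpace X] [CompactSpace X]
    [MeasurableSpace X] [BorelSpace X] [T2Space X] [TopologicalSpace Y] [CompactSpace Y]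
    [T2Space Y] [MeasurableSpace Y] [BorelSpace Y] {μ : Measure X} [μ.Regular]
    [IsFiniteMeasure μ] {l : Measure Y} [l.Regular] (φ : C(X, Y))
    (h : ∀ f : C(Y, ℝ), ∫ x, f (φ x) ∂μ = ∫ y, f y ∂l) : μ.map φ = l := by
  have : (μ.map φ).InnerRegular := Measure.InnerRegular.map_of_continuous φ.continuous
  refine Measure.ext_of_integral_eq_on_compactlySupported fun f => ?_
  have hf : Integrable f (μ.map φ) :=
    f.toContinuousMap.continuous.integrable_of_hasCompactSupport f.hasCompactSupport
  rw [integral_map φ.continuous.aemeasurable hf.aestronglyMeasurable]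
  exact h f.toContinuousMap

/-- A positive functional whose restrictions along `φ` and `ψ` are integration against `l` and
which ignores functions supported in the open set `U` is represented by a measure with the same
properties. -/
theorem exists_measure_map_eq_of_positive {X Y : Type*} [TopologicalSpace X] [CompactSpace X]
    [T2Space X] [MeasurableSpace X] [BorelSpace X] [TopologicalSpace Y] [CompactSpace Y]
    [T2Space Y] [MeasurableSpace Y] [BorelSpace Y] {l : Measure Y} [l.Regular]
    (Φ : boundedFunctions X →ₗ[ℝ] ℝ)
    (hΦ : ∀ k : boundedFunctions X, (∀ x, 0 ≤ k.1 x) → 0 ≤ Φ k) (φ ψ : C(X, Y))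
    (hφ : ∀ f : C(Y, ℝ), Φ ⟨_, (f.comp φ).mem_boundedFunctions⟩ = ∫ y, f y ∂l)
    (hψ : ∀ f : C(Y, ℝ), Φ ⟨_, (f.comp ψ).mem_boundedFunctions⟩ = ∫ y, f y ∂l)
    {U : Set X} (hU : IsOpen U)
    (h0 : ∀ f : C(X, ℝ), EqOn f 0 Uᶜ → Φ ⟨f, f.mem_boundedFunctions⟩ = 0) :
    ∃ μ : Measure X, μ.map φ = l ∧ μ.map ψ = l ∧ μ U = 0 := by
  obtain ⟨μ, hreg, hfin, hμ⟩ := exists_regular_measure_of_positive Φ hΦ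
  exact ⟨μ, map_eq_of_integral_comp_eq φ fun f => (hμ (f.comp φ)).trans (hφ f),
    map_eq_of_integral_comp_eq ψ fun f => (hμ (f.comp ψ)).trans (hψ f),
    measure_eq_zero_of_integral_eq_zero hU fun f hf => (hμ f).trans (h0 f hf)⟩

theorem ExpansionCondition.exists_isCoupling {J : Type*} [MeasurableSpace J] {l : Measure J}
    [IsProbabilityMeasure l] [TopologicalSpace J] [CompactSpace J] [T2Space J] [BorelSpace J]
    [l.Regular] {E : Set (J × J)} (hEm : MeasurableSet E) (hE : IsClosed E)
    (h : ExpansionCondition l E) : ∃ μ : Measure (J × J), IsCoupling l μ ∧ μ Eᶜ = 0 := by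
  obtain ⟨Φ, hpos, hmarg⟩ := h.exists_functional
  have hcont (f : C(J, ℝ)) : ⇑f ∈ boundedMeasurableFunctions J :=
    ⟨f.continuous.measurable, f.mem_boundedFunctions⟩
  -- The Borel sigma-algebra of `J × J` can be strictly larger than the product one, so the measure
  -- is built there and then trimmed.
  have hb : @BorelSpace (J × J) _ (borel _) := @BorelSpace.mk _ _ (borel _) rfl
  obtain ⟨μ, hfst, hsnd, hsupp⟩ := @exists_measure_map_eq_of_positive (J × J) J _ _ _ (borel _)
    hb _ _ _ _ _ l _ Φ (fun k hk => hpos k fun p _ => hk p) ContinuousMap.fst ContinuousMap.snd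
    (fun f => by rw [hmarg _ ⟨f, hcont f⟩ 0 fun p _ => by simp]; simp)
    (fun f => by rw [hmarg _ 0 ⟨f, hcont f⟩ fun p _ => by simp]; simp) Eᶜ hE.isOpen_compl
    (fun f hf => by
      rw [hmarg _ 0 0 fun p hp => by simpa using hf (by simpa using hp)]
      simp)
  have hle : Prod.instMeasurableSpace ≤ borel (J × J) := prod_le_borel_prod
  refine ⟨μ.trim hle, ⟨?_, ?_⟩, ?_⟩
  · ext X hX
    rw [Measure.fst_apply hX, trim_measurableSet_eq hle (measurable_fst hX), ← hfst]
    exact (@Measure.map_apply _ _ (borel _) _ μ _ (measurable_fst.mono hle le_rfl) _ hX).symm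
  · ext X hX
    rw [Measure.snd_apply hX, trim_measurableSet_eq hle (measurable_snd hX), ← hsnd]
    exact (@Measure.map_apply _ _ (borel _) _ μ _ (measurable_snd.mono hle le_rfl) _ hX).symm
  · rw [trim_measurableSet_eq hle hEm.compl, hsupp]

theorem mainTheorem11 {J : Type*} [MeasurableSpace J] (l : Measure J) [IsProbabilityMeasure l]
    (E : Set (J × J)) (hE : MeasurableSet E) :
    ((∃ α : FinAddMeasure (J × J), IsFinAddCoupling l α ∧ α Eᶜ = 0) ↔
      ExpansionCondition l E) ∧
    (∀ [TopologicalSpace J] [CompactSpace J] [T2Space J] [BorelSpace J] [l.Regular],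
      IsClosed E → ExpansionCondition l E →
        ∃ μ : Measure (J × J), IsCoupling l μ ∧ μ Eᶜ = 0) :=
  ⟨⟨fun ⟨_, hα, h0⟩ => hα.expansionCondition hE h0, fun h => h.exists_isFinAddCoupling⟩,
    fun hcl h => h.exists_isCoupling hE hcl⟩
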